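/- Let $n,k\in\mathbb{N}$ and let $R\subseteq \mathrm{GL}_n(\mathbb{R})$ be a finite group generated by (orthogonal) reflections. Let $\Phi$ be its root system, i.e., the set of unit vectors $\alpha$ such that the orthogonal reflection $s_\alpha$ on $\alpha^\perp$ is in $R$, and let $\Phi^+$ be the set of roots that are positive with respect to a given ordered basis of $\mathbb{R}^n$ (the first non-zero coordinate is positive). Let $\Delta\subseteq\Phi^+$ be the simple system, i.e., an inclusion-minimal subset of $\Phi^+$ such that every element of $\Phi^+$ is a conic combination of elements of $\Delta$, and let $S_\Delta=\{s_\alpha \mid \alpha\in\Delta\}$. Let $S_0,S_1,\ldots,S_k\subseteq S_\Delta$ and let $R_i\le R$ be the subgroup generated by $S_i$. Let $G$ be the $(S_0;S_1,\ldots,S_k;S_\Delta)$-left-reflection bigraph, i.e., the bipartite graph with left vertex set $V_1(G)=R/R_0$, right vertex set $V_2(G)=\{(rR_i,i) \mid r\in R,\ 1\le i\le k\}$ and edge set $\{(rR_0,(rR_i,i)) \mid r\in R,\ 1\le i\le k\}$. For a reflection $t\in R$, let $\alpha_t\in\Phi^+$ be the unique positive root with $s_{\alpha_t}=t$, let $H_t=\alpha_t^\perp$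 and $D_t^+=\{x \mid \langle x,\alpha_t\rangle>0\}$, and for $I\subseteq S_\Delta$ let $C(I)=\bigcap_{s\in I}H_s\cap\bigcap_{s\in S_\Delta\setminus I}D_s^+$. The reflection fold of $G$ given by $t$ is the pair $(\phi_t,L_t)$, where $\phi_t(rR_0)=trR_0$, $\phi_t(rR_i,i)=(trR_i,i)$ and $$L_t=\{rR_0 \mid r(C(S_0))\subseteq D_t^+\}\cup\bigcup_{i=1}^k\{(rR_i,i) \mid r(C(S_i))\subseteq D_t^+\}.$$ A fold of a bipartite graph $G$ is a pair $(\phi,L)$, where $\phi$ is an automorphism of $G$ that preserves the two sides, $\phi=\phi^{-1}$, $G-\mathrm{Fix}(\phi)$ is disconnected (it has two vertices that are not joined by a path), $L\subseteq V(G)$ is a union of connected components of $G-\mathrm{Fix}(\phi)$, and $V(G)$ is the disjoint union of $L$, $\mathrm{Fix}(\phi)$ and $\phi(L)$. Its left-folding map $\phi_L$ sends $v$ to $v$ if $v\in L$ and to $\phi(v)$ otherwise. Theorem. Every left-reflection bigraph $G$ is left-cut-percolating under reflection folds: there are $m\in\mathbb{N}$, sets $U_0,U_1,\ldots,U_m\subseteq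 V_1(G)$ with $|U_0|=1$ and $U_m=V_1(G)$, and reflections $t_1,\ldots,t_m\in R$ such that, for every $j\in\{1,\ldots,m\}$, the pair $(\phi_j,L_j)$ given by $\phi_j=\phi_{t_j}$ and $L_j=L_{t_j}$ is a fold of $G$ and $U_j=(\phi_j)_{L_j}^{-1}(U_{j-1})$. -/

import Mathlib

/-! ## Bigraphs -/

/-- A bigraph with left vertex set `V₁` and right vertex set `V₂`, both finite, and edge set
`{(v, w) | Adj v w} ⊆ V₁ × V₂`. The vertex set `V(G)` is the disjoint union `V₁ ⊕ V₂`. -/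
structure Bigraph (V₁ V₂ : Type*) where
  finite_left : Finite V₁
  finite_right : Finite V₂
  Adj : V₁ → V₂ → Prop

namespace Bigraph

variable {V₁ V₂ : Type*} (G : Bigraph V₁ V₂)

/-- The left vertices, as a subset of the vertex set. -/
def leftVerts (_G : Bigraph V₁ V₂) : Set (V₁ ⊕ V₂) := Set.range Sum.inl

/-- The right vertices, as a subset of the vertex set. -/
def rightVerts (_G : Bigraph V₁ V₂) : Set (V₁ ⊕ V₂) := Set.range Sum.inr

/-- `G.Edge x y` says that `(x, y)` is an edge (directed from left to right). -/
def Edge (x y : V₁ ⊕ V₂) : Prop :=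
  ∃ v w, x = Sum.inl v ∧ y = Sum.inr w ∧ G.Adj v w

/-- The underlying (undirected) graph of a bigraph. -/
def toSimpleGraph : SimpleGraph (V₁ ⊕ V₂) where
  Adj x y := G.Edge x y ∨ G.Edge y x
  symm := ⟨fun _ _ h => Or.symm h⟩
  loopless := ⟨by rintro x (⟨v, w, h, h', -⟩ | ⟨v, w, h, h', -⟩) <;> simp [h] at h'⟩

/-- The graph `G - U` obtained by removing the vertices in `U`. -/
def delete (U : Set (V₁ ⊕ V₂)) : SimpleGraph ↥(Uᶜ) := G.toSimpleGraph.induce Uᶜ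

/-- Automorphisms of a bigraph: bijections of the vertex set that preserve the two sides and
that preserve and reflect the edges. -/
def IsAutomorphism (φ : Equiv.Perm (V₁ ⊕ V₂)) : Prop :=
  φ '' G.leftVerts = G.leftVerts ∧ φ '' G.rightVerts = G.rightVerts ∧
    ∀ x y, G.Edge x y ↔ G.Edge (φ x) (φ y)

/-- A cut-involution: an involutive automorphism whose set of fixed points is a vertex-cut, i.e.,
`G - Fix φ` is disconnected (it has two vertices that are not joined by a path). -/
def IsCutInvolution (φ : Equiv.Perm (V₁ ⊕ V₂)) : Prop :=
  G.IsAutomorphism φ ∧ φ = φ⁻¹ ∧ ¬ (G.delete (Function.fixedPoints φ)).Preconnected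

/-- A fold: a cut-involution `φ` with a set `L` of vertices that is a union of connected components
of `G - Fix φ` and such that `(L, Fix φ, φ(L))` is a partition of the vertex set. -/
def IsFold (p : Equiv.Perm (V₁ ⊕ V₂) × Set (V₁ ⊕ V₂)) : Prop :=
  G.IsCutInvolution p.1 ∧
    (∃ 𝒞 : Set (G.delete (Function.fixedPoints p.1)).ConnectedComponent,
      p.2 = ⋃ c ∈ 𝒞, Subtype.val '' c.supp) ∧
    Disjoint p.2 (Function.fixedPoints p.1) ∧
    Disjoint (Function.fixedPoints p.1) (p.1 '' p.2) ∧
    Disjoint p.2 (p.1 '' p.2) ∧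
    p.2 ∪ Function.fixedPoints p.1 ∪ p.1 '' p.2 = Set.univ

open Classical in
/-- The left-folding map `φ_L` of a pair `(φ, L)`. -/
noncomputable def leftFolding (p : Equiv.Perm (V₁ ⊕ V₂) × Set (V₁ ⊕ V₂)) (x : V₁ ⊕ V₂) :
    V₁ ⊕ V₂ :=
  if x ∈ p.2 then x else p.1 x

/-- `U 0, …, U m` is a left-cut-percolating sequence with respect to the sequence of folds
`Φ 0, …, Φ (m - 1)`. -/
def IsLeftCutPercolatingSeq {m : ℕ} (U : Fin (m + 1) → Set (V₁ ⊕ V₂))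
    (Φ : Fin m → Equiv.Perm (V₁ ⊕ V₂) × Set (V₁ ⊕ V₂)) : Prop :=
  (∀ i, U i ⊆ G.leftVerts) ∧
    (U 0).ncard = 1 ∧
    U (Fin.last m) = G.leftVerts ∧
    ∀ i : Fin m, G.IsFold (Φ i) ∧ U i.succ = leftFolding (Φ i) ⁻¹' U i.castSucc

/-- `G` is left-cut-percolating under `S`: it has a left-cut-percolating sequence with respect to
some sequence of folds that belong to `S`. -/
def IsLeftCutPercolatingUnder (S : Set (Equiv.Perm (V₁ ⊕ V₂) × Set (V₁ ⊕ V₂))) : Prop :=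
  ∃ (m : ℕ) (U : Fin (m + 1) → Set (V₁ ⊕ V₂))
    (Φ : Fin m → Equiv.Perm (V₁ ⊕ V₂) × Set (V₁ ⊕ V₂)),
    G.IsLeftCutPercolatingSeq U Φ ∧ ∀ i, Φ i ∈ S

end Bigraph

/-! ## Finite reflection groups -/

namespace ReflGroup

/-- The general linear group of the Euclidean space `ℝⁿ`. -/
abbrev GLE (n : ℕ) : Type := EuclideanSpace ℝ (Fin n) ≃ₗ[ℝ] EuclideanSpace ℝ (Fin n)

variable {n : ℕ}

/-- The (orthogonal) reflection `s_α` on the hyperplane orthogonal to `α`. -/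
noncomputable def refl (α : EuclideanSpace ℝ (Fin n)) : GLE n :=
  ((Submodule.span ℝ {α})ᗮ.reflection).toLinearEquiv

/-- The set of all reflections in `GL_n(ℝ)`. -/
def IsReflection (t : GLE n) : Prop :=
  ∃ α : EuclideanSpace ℝ (Fin n), ‖α‖ = 1 ∧ t = refl α

/-- A finite reflection group: a finite subgroup generated by (its) reflections. -/
def IsFiniteReflectionGroup (R : Subgroup (GLE n)) : Prop :=
  Finite R ∧ Subgroup.closure {t | t ∈ R ∧ IsReflection t} = R

/-- The root system of `R`: the unit vectors orthogonal to the hyperplane of a reflection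
in `R`. -/
def rootSystem (R : Subgroup (GLE n)) : Set (EuclideanSpace ℝ (Fin n)) :=
  {α | ‖α‖ = 1 ∧ refl α ∈ R}

/-- The roots that are positive with respect to the ordered basis `u`: the first non-zero
coordinate in the basis is positive. -/
def positiveRoots (R : Subgroup (GLE n))
    (u : Module.Basis (Fin n) ℝ (EuclideanSpace ℝ (Fin n))) :
    Set (EuclideanSpace ℝ (Fin n)) :=
  {α | α ∈ rootSystem R ∧ ∃ i, 0 < u.repr α i ∧ ∀ j < i, u.repr α j = 0}

/-- A simple system: an inclusion-minimal set of positive roots such that every positive root is a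
conic combination of its elements. -/
def IsSimpleSystem (R : Subgroup (GLE n))
    (u : Module.Basis (Fin n) ℝ (EuclideanSpace ℝ (Fin n)))
    (Δ : Set (EuclideanSpace ℝ (Fin n))) : Prop :=
  Minimal (fun D : Set (EuclideanSpace ℝ (Fin n)) =>
    D ⊆ positiveRoots R u ∧ ∀ α ∈ positiveRoots R u, α ∈ PointedCone.hull ℝ D) Δ

/-- The set `S_Δ` of simple reflections. -/
def simpleReflections (Δ : Set (EuclideanSpace ℝ (Fin n))) : Set (GLE n) := refl '' Δ

/-- The hyperplane `H_t` orthogonal to `α_t`, the (unique) positive root with `s_{α_t} = t`. -/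
def hyperplane (R : Subgroup (GLE n))
    (u : Module.Basis (Fin n) ℝ (EuclideanSpace ℝ (Fin n))) (t : GLE n) :
    Set (EuclideanSpace ℝ (Fin n)) :=
  {x | ∃ α ∈ positiveRoots R u, refl α = t ∧ inner ℝ x α = 0}

/-- The open half-space `D_t⁺ = {x | ⟨x, α_t⟩ > 0}`, for `α_t` the (unique) positive root with
`s_{α_t} = t`. -/
def posHalfSpace (R : Subgroup (GLE n))
    (u : Module.Basis (Fin n) ℝ (EuclideanSpace ℝ (Fin n))) (t : GLE n) :
    Set (EuclideanSpace ℝ (Fin n)) :=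
  {x | ∃ α ∈ positiveRoots R u, refl α = t ∧ 0 < inner ℝ x α}

/-- The set `C(I)`, for `I ⊆ S_Δ`. -/
def cell (R : Subgroup (GLE n)) (u : Module.Basis (Fin n) ℝ (EuclideanSpace ℝ (Fin n)))
    (Δ : Set (EuclideanSpace ℝ (Fin n))) (I : Set (GLE n)) :
    Set (EuclideanSpace ℝ (Fin n)) :=
  (⋂ s ∈ I, hyperplane R u s) ∩ ⋂ s ∈ simpleReflections Δ \ I, posHalfSpace R u s

/-- The subgroup of `R` generated by a set `I` of elements of `R`. -/
def gen (R : Subgroup (GLE n)) (I : Set (GLE n)) : Subgroup R :=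
  (Subgroup.closure I).subgroupOf R

/-- The `(S₀; S 0, …, S (k - 1); S_Δ)`-left-reflection bigraph: left vertices are the left cosets
`r R₀`, right vertices are the pairs `⟨i, r Rᵢ⟩`, and the edges are the pairs
`(r R₀, ⟨i, r Rᵢ⟩)`. -/
def leftReflectionBigraph (R : Subgroup (GLE n)) (hR : IsFiniteReflectionGroup R) {k : ℕ}
    (S₀ : Set (GLE n)) (S : Fin k → Set (GLE n)) :
    Bigraph (R ⧸ gen R S₀) (Σ i : Fin k, R ⧸ gen R (S i)) where
  finite_left := by
    have := hR.1
    infer_instance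
  finite_right := by
    have := hR.1
    infer_instance
  Adj v w := ∃ (r : R) (i : Fin k), v = (r : R ⧸ gen R S₀) ∧ w = ⟨i, (r : R ⧸ gen R (S i))⟩

/-- The permutation `r R₀ ↦ t r R₀`, `⟨i, r Rᵢ⟩ ↦ ⟨i, t r Rᵢ⟩`. -/
def reflectionPerm (R : Subgroup (GLE n)) {k : ℕ} (S₀ : Set (GLE n)) (S : Fin k → Set (GLE n))
    (t : R) : Equiv.Perm ((R ⧸ gen R S₀) ⊕ (Σ i : Fin k, R ⧸ gen R (S i))) :=
  Equiv.sumCongr (MulAction.toPerm t) (Equiv.sigmaCongrRight fun _ => MulAction.toPerm t)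

/-- The set of left cosets `r R₀` with `r(C(S₀)) ⊆ D_t⁺` and of pairs `⟨i, r Rᵢ⟩` with
`r(C(Sᵢ)) ⊆ D_t⁺`. -/
def reflectionSide (R : Subgroup (GLE n))
    (u : Module.Basis (Fin n) ℝ (EuclideanSpace ℝ (Fin n)))
    (Δ : Set (EuclideanSpace ℝ (Fin n))) {k : ℕ} (S₀ : Set (GLE n)) (S : Fin k → Set (GLE n))
    (t : R) : Set ((R ⧸ gen R S₀) ⊕ (Σ i : Fin k, R ⧸ gen R (S i))) :=
  {x | ∃ r : R, x = Sum.inl (r : R ⧸ gen R S₀) ∧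
      (r : GLE n) '' cell R u Δ S₀ ⊆ posHalfSpace R u t} ∪
  {x | ∃ (i : Fin k) (r : R), x = Sum.inr ⟨i, (r : R ⧸ gen R (S i))⟩ ∧
      (r : GLE n) '' cell R u Δ (S i) ⊆ posHalfSpace R u t}

/-- The set of reflection folds of the left-reflection bigraph, one for each reflection
`t ∈ R`. -/
def reflectionFolds (R : Subgroup (GLE n))
    (u : Module.Basis (Fin n) ℝ (EuclideanSpace ℝ (Fin n)))
    (Δ : Set (EuclideanSpace ℝ (Fin n))) {k : ℕ} (S₀ : Set (GLE n))
    (S : Fin k → Set (GLE n)) :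
    Set (Equiv.Perm ((R ⧸ gen R S₀) ⊕ (Σ i : Fin k, R ⧸ gen R (S i))) ×
      Set ((R ⧸ gen R S₀) ⊕ (Σ i : Fin k, R ⧸ gen R (S i)))) :=
  {p | ∃ t : R, IsReflection (t : GLE n) ∧
    p = (reflectionPerm R S₀ S t, reflectionSide R u Δ S₀ S t)}

end ReflGroup

/-! Cosets become points. Fix `x₀` in C(S₀) and `x i` in C(S i). The stabilizer of such a point in R
is exactly the subgroup generated by the corresponding simple reflections, so r R₀ ↦ r x₀ and r Rᵢ ↦
r (x i) are well defined and injective, and t acts on vertices as it acts on points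
(`mem_closure_iff`, `cosetPoint_smul`). This rests on the classical theory of simple systems: linear
independence, generation by simple reflections, and the exchange property.

For a positive root α, the inner product with α is a height on the vertices. It is negated by s_α,
vanishes exactly at the fixed vertices and is positive exactly on the chosen side. The ends of an
edge lie in a common closed chamber r C, which no root hyperplane separates, so they never have
heights of opposite strict signs. Hence s_α gives a fold as soon as it moves a vertex
(`isFold_of_height`, `isFold_reflection`).

For percolation, take ρ with positive inner product with all simple roots. Folding by a simple α
adds a non-negative multiple of α to each left point, so its inner product with ρ never drops. A
left point other than x₀ is not dominant, so some simple fold strictly raises it. A composition of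
folds that maximizes the sum of these inner products over all left vertices therefore sends every
left vertex to R₀, and preimages of {R₀} under its partial compositions form the sequence. -/

namespace ReflGroup

open scoped InnerProductSpace

/-! ### Lexicographically positive vectors -/

/-- The first non-zero coordinate of `v` in the ordered basis `u` is positive. -/
def LexPos {n : ℕ} (u : Module.Basis (Fin n) ℝ (EuclideanSpace ℝ (Fin n)))
    (v : EuclideanSpace ℝ (Fin n)) : Prop :=
  ∃ i, 0 < u.repr v i ∧ ∀ j < i, u.repr v j = 0

section LexPos

variable {n : ℕ} {u : Module.Basis (Fin n) ℝ (EuclideanSpace ℝ (Fin n))}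
  {v w : EuclideanSpace ℝ (Fin n)}

theorem LexPos.add (hv : LexPos u v) (hw : LexPos u w) : LexPos u (v + w) := by
  obtain ⟨i, hi, hi'⟩ := hv
  obtain ⟨j, hj, hj'⟩ := hw
  rcases lt_trichotomy i j with h | rfl | h
  · exact ⟨i, by simp [hj' i h, hi], fun l hl => by simp [hi' l hl, hj' l (hl.trans h)]⟩
  · exact ⟨i, by simp [add_pos hi hj], fun l hl => by simp [hi' l hl, hj' l hl]⟩
  · exact ⟨j, by simp [hi' j h, hj], fun l hl => by simp [hj' l hl, hi' l (hl.trans h)]⟩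

theorem LexPos.smul {c : ℝ} (hc : 0 < c) (hv : LexPos u v) : LexPos u (c • v) := by
  obtain ⟨i, hi, hi'⟩ := hv
  exact ⟨i, by simp [hc, hi], fun l hl => by simp [hi' l hl]⟩

theorem not_lexPos_zero : ¬ LexPos u 0 := by
  rintro ⟨i, hi, -⟩
  simp at hi

theorem lexPos_or_neg (hv : v ≠ 0) : LexPos u v ∨ LexPos u (-v) := by
  have hne : ∃ i, u.repr v i ≠ 0 := by
    by_contra! h
    exact hv (u.repr.map_eq_zero_iff.mp (Finsupp.ext h))
  classical
  have hm := Fin.find_spec hne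
  have hlt : ∀ j < Fin.find _ hne, u.repr v j = 0 := fun j hj => by
    simpa using Fin.find_min hne hj
  rcases lt_or_gt_of_ne hm with h | h
  · exact Or.inr ⟨_, by simpa using h, fun j hj => by simp [hlt j hj]⟩
  · exact Or.inl ⟨_, h, hlt⟩

theorem LexPos.not_neg (hv : LexPos u v) : ¬ LexPos u (-v) := fun h =>
  not_lexPos_zero (u := u) (by simpa using hv.add h)

theorem LexPos.add_of_eq_zero_or (hv : LexPos u v) (hw : w = 0 ∨ LexPos u w) :
    LexPos u (v + w) := by
  rcases hw with rfl | hw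
  · simpa using hv
  · exact hv.add hw

theorem eq_zero_or_lexPos_add (hv : v = 0 ∨ LexPos u v) (hw : w = 0 ∨ LexPos u w) :
    v + w = 0 ∨ LexPos u (v + w) := by
  rcases hv with rfl | hv
  · simpa using hw
  · exact Or.inr (hv.add_of_eq_zero_or hw)

theorem eq_zero_or_lexPos_smul {c : ℝ} (hc : 0 ≤ c) (hv : v = 0 ∨ LexPos u v) :
    c • v = 0 ∨ LexPos u (c • v) := by
  rcases hc.eq_or_lt with rfl | hc
  · simp
  rcases hv with rfl | hv
  · simp
  · exact Or.inr (hv.smul hc)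

theorem eq_zero_or_lexPos_sum {ι : Type*} (s : Finset ι) (f : ι → EuclideanSpace ℝ (Fin n))
    (h : ∀ i ∈ s, f i = 0 ∨ LexPos u (f i)) : ∑ i ∈ s, f i = 0 ∨ LexPos u (∑ i ∈ s, f i) :=
  Finset.sum_induction f (fun v => v = 0 ∨ LexPos u v) (fun _ _ => eq_zero_or_lexPos_add)
    (Or.inl rfl) h

/-- A single positive coefficient would make the whole sum lexicographically positive, since the
remaining terms add up to zero or to a positive vector. -/
theorem eq_zero_of_sum_smul_eq_zero {ι : Type*} (s : Finset ι) (c : ι → ℝ)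
    (f : ι → EuclideanSpace ℝ (Fin n)) (hc : ∀ i ∈ s, 0 ≤ c i) (hf : ∀ i, LexPos u (f i))
    (h : ∑ i ∈ s, c i • f i = 0) : ∀ i ∈ s, c i = 0 := by
  classical
  intro i hi
  by_contra hne
  have hpos : 0 < c i := lt_of_le_of_ne (hc i hi) (Ne.symm hne)
  rw [← Finset.add_sum_erase s _ hi] at h
  refine not_lexPos_zero (u := u) (h ▸ ((hf i).smul hpos).add_of_eq_zero_or ?_)
  exact eq_zero_or_lexPos_sum _ _ fun j hj =>
    eq_zero_or_lexPos_smul (hc j (Finset.mem_of_mem_erase hj)) (Or.inr (hf j))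

theorem eq_zero_or_lexPos_of_mem_hull {D : Set (EuclideanSpace ℝ (Fin n))}
    (hD : ∀ d ∈ D, LexPos u d) (hv : v ∈ PointedCone.hull ℝ D) : v = 0 ∨ LexPos u v := by
  induction hv using Submodule.span_induction with
  | mem x hx => exact Or.inr (hD x hx)
  | zero => exact Or.inl rfl
  | add x y _ _ hx hy => exact eq_zero_or_lexPos_add hx hy
  | smul a x _ hx => exact eq_zero_or_lexPos_smul a.2 hx

end LexPos

/-! ### Obtuse systems of vectors -/

section Obtuse

variable {n : ℕ} {u : Module.Basis (Fin n) ℝ (EuclideanSpace ℝ (Fin n))}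

/-- Pairwise obtuse vectors in an open half-space are linearly independent. -/
theorem linearIndependent_of_obtuse {ι : Type*} (f : ι → EuclideanSpace ℝ (Fin n))
    (hf : ∀ i, LexPos u (f i)) (hob : ∀ i j, i ≠ j → ⟪f i, f j⟫_ℝ ≤ 0) :
    LinearIndependent ℝ f := by
  rw [linearIndependent_iff']
  intro s g hg
  -- The positive and the negative part of the relation represent the same vector.
  have hsplit : ∑ i ∈ s, max (g i) 0 • f i = ∑ i ∈ s, max (-g i) 0 • f i := by
    rw [← sub_eq_zero, ← Finset.sum_sub_distrib, ← hg]
    refine Finset.sum_congr rfl fun i _ => ?_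
    rw [← sub_smul]
    congr 1
    rcases le_total (g i) 0 with h | h
    · rw [max_eq_right h, max_eq_left (by linarith)]; ring
    · rw [max_eq_left h, max_eq_right (by linarith)]; ring
  -- Pairing the two representations, diagonal terms vanish because the two parts of `g i` have
  -- disjoint support, and the others are non-positive by obtuseness.
  have hnonpos : ⟪∑ i ∈ s, max (g i) 0 • f i, ∑ i ∈ s, max (g i) 0 • f i⟫_ℝ ≤ 0 := by
    nth_rewrite 2 [hsplit]
    rw [sum_inner]
    refine Finset.sum_nonpos fun i _ => ?_
    rw [inner_sum]
    refine Finset.sum_nonpos fun j _ => ?_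
    rw [real_inner_smul_left, real_inner_smul_right]
    by_cases hij : i = j
    · subst hij
      rcases le_total (g i) 0 with h | h
      · simp [max_eq_right h]
      · simp [max_eq_right (neg_nonpos.mpr h)]
    · exact mul_nonpos_of_nonneg_of_nonpos (le_max_right _ _)
        (mul_nonpos_of_nonneg_of_nonpos (le_max_right _ _) (hob i j hij))
  have hzero : ∑ i ∈ s, max (g i) 0 • f i = 0 := real_inner_self_nonpos.mp hnonpos
  intro i hi
  have h1 := eq_zero_of_sum_smul_eq_zero s _ f (fun j _ => le_max_right (g j) 0) hf hzero i hi
  have h2 := eq_zero_of_sum_smul_eq_zero s _ f (fun j _ => le_max_right (-g j) 0) hf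
    (hsplit ▸ hzero) i hi
  have h3 := le_max_left (g i) 0
  have h4 := le_max_left (-g i) 0
  linarith

/-- Prescribed inner products with linearly independent vectors can be realised. -/
theorem exists_inner_eq {ι : Type*} {f : ι → EuclideanSpace ℝ (Fin n)}
    (hf : LinearIndependent ℝ f) (c : ι → ℝ) : ∃ x, ∀ i, ⟪x, f i⟫_ℝ = c i := by
  -- The functional prescribed on the span extends to the whole space and is represented by a
  -- vector.
  obtain ⟨g, hg⟩ := LinearMap.exists_extend ((Module.Basis.span hf).constr ℝ c)
  refine ⟨(InnerProductSpace.toDual ℝ _).symm (LinearMap.toContinuousLinearMap g), fun i => ?_⟩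
  rw [InnerProductSpace.toDual_symm_apply]
  have h := LinearMap.congr_fun hg (Module.Basis.span hf i)
  rw [Module.Basis.constr_basis] at h
  rw [← h]
  simp [Module.Basis.span_apply]

end Obtuse

/-! ### Reflections -/

section Refl

variable {n : ℕ} {α x y : EuclideanSpace ℝ (Fin n)}

theorem refl_apply (hα : ‖α‖ = 1) (x : EuclideanSpace ℝ (Fin n)) :
    refl α x = x - (2 * ⟪x, α⟫_ℝ) • α := by
  change (Submodule.span ℝ {α})ᗮ.reflection x = _
  rw [Submodule.reflection_orthogonal_apply, Submodule.reflection_singleton_apply, hα,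
    real_inner_comm]
  simp [two_smul, two_mul, add_smul]

theorem refl_self (hα : ‖α‖ = 1) : refl α α = -α := by
  rw [refl_apply hα, real_inner_self_eq_norm_sq, hα]
  module

theorem refl_inner (x y : EuclideanSpace ℝ (Fin n)) : ⟪refl α x, refl α y⟫_ℝ = ⟪x, y⟫_ℝ :=
  (Submodule.span ℝ {α})ᗮ.reflection.inner_map_map x y

theorem refl_refl (x : EuclideanSpace ℝ (Fin n)) : refl α (refl α x) = x :=
  (Submodule.span ℝ {α})ᗮ.reflection_reflection x

theorem refl_mul_self : refl α * refl α = 1 :=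
  LinearEquiv.ext fun x => by rw [LinearEquiv.mul_apply]; exact refl_refl x

theorem refl_inv : (refl α)⁻¹ = refl α := inv_eq_of_mul_eq_one_left refl_mul_self

theorem refl_neg : refl (-α) = refl α := by
  unfold refl
  congr 3
  rw [← Set.neg_singleton, Submodule.span_neg]

theorem refl_eq_self_iff (hα : ‖α‖ = 1) : refl α x = x ↔ ⟪x, α⟫_ℝ = 0 := by
  have hne : α ≠ 0 := by
    rintro rfl
    simp at hα
  rw [refl_apply hα, sub_eq_self]
  simp [hne]

theorem inner_refl (x y : EuclideanSpace ℝ (Fin n)) : ⟪refl α x, y⟫_ℝ = ⟪x, refl α y⟫_ℝ := by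
  rw [← refl_inner (α := α) x, refl_refl]

/-- Conjugating a reflection by an isometry gives a reflection. -/
theorem refl_map {r : GLE n} (hr : ∀ x y, ⟪r x, r y⟫_ℝ = ⟪x, y⟫_ℝ) (hα : ‖α‖ = 1) :
    ‖r α‖ = 1 ∧ refl (r α) = r * refl α * r⁻¹ := by
  have hn : ‖r α‖ = 1 := by
    rw [norm_eq_sqrt_real_inner, hr, ← norm_eq_sqrt_real_inner, hα]
  refine ⟨hn, LinearEquiv.ext fun x => ?_⟩
  obtain ⟨y, rfl⟩ := r.surjective x
  have h : r⁻¹ (r y) = y := r.symm_apply_apply y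
  rw [LinearEquiv.mul_apply, LinearEquiv.mul_apply, h, refl_apply hn, refl_apply hα, hr]
  simp

end Refl

end ReflGroup

namespace ReflGroup

open scoped InnerProductSpace

/-! ### Roots and positive roots -/

section Roots

variable {n : ℕ} {R : Subgroup (GLE n)}
  {u : Module.Basis (Fin n) ℝ (EuclideanSpace ℝ (Fin n))} {α β x y : EuclideanSpace ℝ (Fin n)}

theorem inner_map_map (hR : IsFiniteReflectionGroup R) {r : GLE n} (hr : r ∈ R)
    (x y : EuclideanSpace ℝ (Fin n)) : ⟪r x, r y⟫_ℝ = ⟪x, y⟫_ℝ := by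
  rw [← hR.2] at hr
  induction hr using Subgroup.closure_induction generalizing x y with
  | mem t ht =>
    obtain ⟨-, α, -, rfl⟩ := ht
    exact refl_inner x y
  | one => rfl
  | mul a b _ _ ha hb => rw [LinearEquiv.mul_apply, LinearEquiv.mul_apply, ha, hb]
  | inv a _ ha =>
    rw [← ha]
    congr 1 <;> exact a.apply_symm_apply _

theorem inner_map_left (hR : IsFiniteReflectionGroup R) {r : GLE n} (hr : r ∈ R)
    (x y : EuclideanSpace ℝ (Fin n)) : ⟪r x, y⟫_ℝ = ⟪x, r⁻¹ y⟫_ℝ := by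
  rw [← inner_map_map hR hr x]
  congr 1
  exact (r.apply_symm_apply y).symm

theorem map_mem_rootSystem (hR : IsFiniteReflectionGroup R) {r : GLE n} (hr : r ∈ R)
    (hα : α ∈ rootSystem R) : r α ∈ rootSystem R := by
  obtain ⟨h1, h2⟩ := refl_map (inner_map_map hR hr) hα.1
  exact ⟨h1, h2 ▸ R.mul_mem (R.mul_mem hr hα.2) (R.inv_mem hr)⟩

theorem refl_map_eq (hR : IsFiniteReflectionGroup R) {r : GLE n} (hr : r ∈ R)
    (hα : α ∈ rootSystem R) : refl (r α) = r * refl α * r⁻¹ :=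
  (refl_map (inner_map_map hR hr) hα.1).2

theorem ne_zero_of_mem_rootSystem (hα : α ∈ rootSystem R) : α ≠ 0 := by
  rintro rfl
  simpa using hα.1

theorem neg_mem_rootSystem (hα : α ∈ rootSystem R) : -α ∈ rootSystem R :=
  ⟨by rw [norm_neg, hα.1], by rw [refl_neg]; exact hα.2⟩

theorem mem_positiveRoots_or_neg (hα : α ∈ rootSystem R) :
    α ∈ positiveRoots R u ∨ -α ∈ positiveRoots R u :=
  (lexPos_or_neg (u := u) (ne_zero_of_mem_rootSystem hα)).imp (fun h => ⟨hα, h⟩)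
    fun h => ⟨neg_mem_rootSystem hα, h⟩

theorem neg_notMem_positiveRoots (hα : α ∈ positiveRoots R u) : -α ∉ positiveRoots R u :=
  fun h => LexPos.not_neg hα.2 h.2

/-- A positive root is determined by its reflection. -/
theorem eq_of_refl_eq (hα : α ∈ positiveRoots R u) (hβ : β ∈ positiveRoots R u)
    (h : refl α = refl β) : α = β := by
  have h1 := refl_self hα.1.1
  rw [h, refl_apply hβ.1.1] at h1
  have h2 : α = ⟪α, β⟫_ℝ • β := by
    have h4 : (2 : ℝ) • α = (2 : ℝ) • (⟪α, β⟫_ℝ • β) := by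
      rw [smul_smul, two_smul]
      nth_rewrite 1 [← sub_eq_zero]
      rw [sub_eq_iff_eq_add] at h1
      nth_rewrite 1 [h1]
      module
    exact smul_right_injective _ two_ne_zero h4
  have h3 : |⟪α, β⟫_ℝ| = 1 := by
    have := congrArg norm h2
    rw [norm_smul, hα.1.1, hβ.1.1, mul_one, Real.norm_eq_abs] at this
    exact this.symm
  rcases eq_or_eq_neg_of_abs_eq h3 with h5 | h5
  · rw [h2, h5, one_smul]
  · rw [h5, neg_one_smul] at h2
    exact absurd (h2 ▸ hα) (neg_notMem_positiveRoots hβ)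

theorem finite_positiveRoots (hR : IsFiniteReflectionGroup R) : (positiveRoots R u).Finite := by
  have := hR.1
  refine Set.Finite.of_finite_image (f := refl) ((Set.toFinite (R : Set (GLE n))).subset ?_)
    fun a ha b hb h => eq_of_refl_eq ha hb h
  rintro _ ⟨a, ha, rfl⟩
  exact ha.1.2

end Roots

/-! ### Simple systems -/

namespace IsSimpleSystem

variable {n : ℕ} {R : Subgroup (GLE n)}
  {u : Module.Basis (Fin n) ℝ (EuclideanSpace ℝ (Fin n))} {Δ : Set (EuclideanSpace ℝ (Fin n))}
  {α β γ x y : EuclideanSpace ℝ (Fin n)}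

theorem pos (hΔ : IsSimpleSystem R u Δ) (hα : α ∈ Δ) : α ∈ positiveRoots R u := hΔ.prop.1 hα

theorem lexPos (hΔ : IsSimpleSystem R u Δ) (hα : α ∈ Δ) : LexPos u α := (hΔ.pos hα).2

theorem norm_eq (hΔ : IsSimpleSystem R u Δ) (hα : α ∈ Δ) : ‖α‖ = 1 := (hΔ.pos hα).1.1

theorem mem_hull (hΔ : IsSimpleSystem R u Δ) (hβ : β ∈ positiveRoots R u) :
    β ∈ PointedCone.hull ℝ Δ := hΔ.prop.2 β hβ

theorem notMem_hull_diff (hΔ : IsSimpleSystem R u Δ) (hγ : γ ∈ Δ) :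
    γ ∉ PointedCone.hull ℝ (Δ \ {γ}) := by
  intro h
  have hsub : Δ ⊆ PointedCone.hull ℝ (Δ \ {γ}) := fun δ hδ => by
    by_cases hδγ : δ = γ
    · exact hδγ ▸ h
    · exact Submodule.subset_span ⟨hδ, hδγ⟩
  have hmin := hΔ.le_of_le (y := Δ \ {γ})
    ⟨Set.sdiff_subset.trans hΔ.prop.1,
      fun α hα => Submodule.span_le.mpr hsub (hΔ.mem_hull hα)⟩ Set.sdiff_subset
  exact (hmin hγ).2 rfl

/-- Otherwise γ - c α = a γ + z with z in the cone of the other simple roots. If a < 1, then γ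
itself lies in that cone, against minimality; if a ≥ 1, then a lexicographically positive vector
vanishes. -/
theorem sub_smul_notMem_hull (hΔ : IsSimpleSystem R u Δ) (hα : α ∈ Δ) (hγ : γ ∈ Δ) (hne : α ≠ γ)
    {c : ℝ} (hc : 0 < c) : γ - c • α ∉ PointedCone.hull ℝ Δ := by
  intro h
  rw [PointedCone.hull, ← Set.insert_sdiff_self_of_mem hγ, Submodule.mem_span_insert] at h
  obtain ⟨a, z, hz, he⟩ := h
  have he' : γ - c • α = (a : ℝ) • γ + z := he
  have hαz : c • α + z ∈ PointedCone.hull ℝ (Δ \ {γ}) := by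
    refine Submodule.add_mem _ ?_ hz
    exact Submodule.smul_mem _ (⟨c, hc.le⟩ : {c : ℝ // 0 ≤ c})
      (Submodule.subset_span ⟨hα, hne⟩)
  have hsum : (1 - (a : ℝ)) • γ = c • α + z := by
    rw [sub_eq_iff_eq_add] at he'
    calc (1 - (a : ℝ)) • γ = γ - (a : ℝ) • γ := by module
      _ = (a : ℝ) • γ + z + c • α - (a : ℝ) • γ := congrArg (· - (a : ℝ) • γ) he'
      _ = c • α + z := by abel
  rcases lt_or_ge (a : ℝ) 1 with ha | ha
  · refine hΔ.notMem_hull_diff hγ ?_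
    have hpos : 0 < 1 - (a : ℝ) := by linarith
    have h2 := Submodule.smul_mem _ (⟨(1 - (a : ℝ))⁻¹, (inv_pos.mpr hpos).le⟩ : {c : ℝ // 0 ≤ c})
      hαz
    rw [← hsum] at h2
    have h3 : (⟨(1 - (a : ℝ))⁻¹, (inv_pos.mpr hpos).le⟩ : {c : ℝ // 0 ≤ c}) •
        ((1 - (a : ℝ)) • γ) = γ := by
      change (1 - (a : ℝ))⁻¹ • ((1 - (a : ℝ)) • γ) = γ
      exact inv_smul_smul₀ hpos.ne' γ
    rwa [h3] at h2
  · have hz' : z = 0 ∨ LexPos u z :=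
      eq_zero_or_lexPos_of_mem_hull (fun d hd => hΔ.lexPos hd.1) hz
    have h1 : LexPos u (c • α + z) := ((hΔ.lexPos hα).smul hc).add_of_eq_zero_or hz'
    have h2 : LexPos u (c • α + z + ((a : ℝ) - 1) • γ) :=
      h1.add_of_eq_zero_or (eq_zero_or_lexPos_smul (by linarith) (Or.inr (hΔ.lexPos hγ)))
    have h3 : c • α + z + ((a : ℝ) - 1) • γ = 0 := by
      rw [← hsum]
      module
    exact not_lexPos_zero (h3 ▸ h2)

/-- If the product were positive, the root s_α γ would be γ - c α with c > 0. Either it or its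
negative is a conic combination of simple roots, and `sub_smul_notMem_hull` excludes both. -/
theorem inner_nonpos (hR : IsFiniteReflectionGroup R) (hΔ : IsSimpleSystem R u Δ) (hα : α ∈ Δ)
    (hγ : γ ∈ Δ) (hne : α ≠ γ) : ⟪α, γ⟫_ℝ ≤ 0 := by
  by_contra! h
  have hroot : refl α γ ∈ rootSystem R :=
    map_mem_rootSystem hR (hΔ.pos hα).1.2 (hΔ.pos hγ).1
  rw [refl_apply (hΔ.norm_eq hα), real_inner_comm] at hroot
  set c := 2 * ⟪α, γ⟫_ℝ with hc
  have hcpos : 0 < c := by positivity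
  rcases mem_positiveRoots_or_neg (u := u) hroot with h1 | h1
  · exact hΔ.sub_smul_notMem_hull hα hγ hne hcpos (hΔ.mem_hull h1)
  · refine hΔ.sub_smul_notMem_hull hγ hα hne.symm (inv_pos.mpr hcpos) ?_
    have h2 := Submodule.smul_mem _ (⟨c⁻¹, (inv_pos.mpr hcpos).le⟩ : {c : ℝ // 0 ≤ c})
      (hΔ.mem_hull h1)
    have h3 : (⟨c⁻¹, (inv_pos.mpr hcpos).le⟩ : {c : ℝ // 0 ≤ c}) • -(γ - c • α)
        = α - c⁻¹ • γ := by
      change c⁻¹ • -(γ - c • α) = α - c⁻¹ • γ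
      rw [neg_sub, smul_sub, inv_smul_smul₀ hcpos.ne']
    rwa [h3] at h2

theorem linearIndependent (hR : IsFiniteReflectionGroup R) (hΔ : IsSimpleSystem R u Δ) :
    LinearIndependent ℝ ((↑) : Δ → EuclideanSpace ℝ (Fin n)) :=
  linearIndependent_of_obtuse (u := u) _ (fun i => hΔ.lexPos i.2)
    fun i j hij => hΔ.inner_nonpos hR i.2 j.2 (Subtype.coe_ne_coe.mpr hij)

/-- `x` lies in the closed fundamental chamber. -/
def _root_.ReflGroup.IsDominant (Δ : Set (EuclideanSpace ℝ (Fin n)))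
    (x : EuclideanSpace ℝ (Fin n)) : Prop := ∀ α ∈ Δ, 0 ≤ ⟪x, α⟫_ℝ

theorem inner_nonneg_of_isDominant (hΔ : IsSimpleSystem R u Δ) (hx : IsDominant Δ x)
    (hβ : β ∈ positiveRoots R u) : 0 ≤ ⟪x, β⟫_ℝ := by
  have h := hΔ.mem_hull hβ
  clear hβ
  induction h using Submodule.span_induction with
  | mem y hy => exact hx y hy
  | zero => simp
  | add y z _ _ hy hz => rw [inner_add_right]; exact add_nonneg hy hz
  | smul a y _ hy =>
    change 0 ≤ ⟪x, (a : ℝ) • y⟫_ℝ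
    rw [real_inner_smul_right]
    exact mul_nonneg a.2 hy

/-- By linear independence, every face of the chamber contains a point. The case I = ∅ supplies ρ,
and I = {α} a point on the wall of α only. -/
theorem exists_inner_eq_zero_iff (hR : IsFiniteReflectionGroup R) (hΔ : IsSimpleSystem R u Δ)
    (I : Set (EuclideanSpace ℝ (Fin n))) :
    ∃ x, IsDominant Δ x ∧ ∀ α ∈ Δ, ⟪x, α⟫_ℝ = 0 ↔ α ∈ I := by
  classical
  obtain ⟨x, hx⟩ := exists_inner_eq (hΔ.linearIndependent hR)
    fun i => if (i : EuclideanSpace ℝ (Fin n)) ∈ I then 0 else 1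
  refine ⟨x, fun α hα => ?_, fun α hα => ?_⟩
  · rw [hx ⟨α, hα⟩]; split_ifs <;> norm_num
  · rw [hx ⟨α, hα⟩]; simp

/-- If `x` is dominant and orthogonal to no simple root but `α`, then `α` is the only positive
root orthogonal to `x`, if any. -/
theorem eq_of_inner_eq_zero (hΔ : IsSimpleSystem R u Δ) (hα : α ∈ Δ)
    (hx : ∀ γ ∈ Δ, γ ≠ α → 0 < ⟪x, γ⟫_ℝ) (hxα : ⟪x, α⟫_ℝ = 0) (hβ : β ∈ positiveRoots R u)
    (h : ⟪x, β⟫_ℝ = 0) : β = α := by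
  -- The face of the cone on which x vanishes is the ray of α; unit length then determines the root.
  have key : ∀ v ∈ PointedCone.hull ℝ Δ, 0 ≤ ⟪x, v⟫_ℝ ∧
      (⟪x, v⟫_ℝ = 0 → ∃ c : ℝ, 0 ≤ c ∧ v = c • α) := by
    intro v hv
    induction hv using Submodule.span_induction with
    | mem y hy =>
      by_cases hyα : y = α
      · subst hyα
        exact ⟨hxα.ge, fun _ => ⟨1, zero_le_one, (one_smul _ _).symm⟩⟩
      · exact ⟨(hx y hy hyα).le, fun h0 => absurd h0 (hx y hy hyα).ne'⟩
    | zero => exact ⟨by simp, fun _ => ⟨0, le_rfl, by simp⟩⟩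
    | add y z _ _ hy hz =>
      rw [inner_add_right]
      refine ⟨add_nonneg hy.1 hz.1, fun h0 => ?_⟩
      rw [add_eq_zero_iff_of_nonneg hy.1 hz.1] at h0
      obtain ⟨a, ha, rfl⟩ := hy.2 h0.1
      obtain ⟨b, hb, rfl⟩ := hz.2 h0.2
      exact ⟨a + b, add_nonneg ha hb, (add_smul _ _ _).symm⟩
    | smul a y _ hy =>
      change 0 ≤ ⟪x, (a : ℝ) • y⟫_ℝ ∧
        (⟪x, (a : ℝ) • y⟫_ℝ = 0 → ∃ c : ℝ, 0 ≤ c ∧ (a : ℝ) • y = c • α)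
      rw [real_inner_smul_right]
      refine ⟨mul_nonneg a.2 hy.1, fun h0 => ?_⟩
      rcases mul_eq_zero.mp h0 with h0 | h0
      · exact ⟨0, le_rfl, by rw [h0, zero_smul, zero_smul]⟩
      · obtain ⟨c, hc, rfl⟩ := hy.2 h0
        exact ⟨a * c, mul_nonneg a.2 hc, smul_smul _ _ _⟩
  obtain ⟨c, hc, rfl⟩ := (key β (hΔ.mem_hull hβ)).2 h
  have h1 := hβ.1.1
  rw [norm_smul, hΔ.norm_eq hα, mul_one, Real.norm_eq_abs, abs_of_nonneg hc] at h1
  rw [h1, one_smul]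

/-- A simple reflection permutes the other positive roots. -/
theorem refl_mem_positiveRoots (hR : IsFiniteReflectionGroup R) (hΔ : IsSimpleSystem R u Δ)
    (hα : α ∈ Δ) (hβ : β ∈ positiveRoots R u) (hne : β ≠ α) : refl α β ∈ positiveRoots R u := by
  obtain ⟨x, hx, hx'⟩ := hΔ.exists_inner_eq_zero_iff hR {α}
  have hxα : ⟪x, α⟫_ℝ = 0 := (hx' α hα).mpr rfl
  -- The reflection s_α fixes x, so β and s_α β have the same inner product with x. If s_α β were
  -- negative, this product would be 0, which forces β = α.
  rcases mem_positiveRoots_or_neg (u := u) (map_mem_rootSystem hR (hΔ.pos hα).1.2 hβ.1) with h | h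
  · exact h
  · refine absurd (hΔ.eq_of_inner_eq_zero hα (fun γ hγ hγα => ?_) hxα hβ ?_) hne
    · exact lt_of_le_of_ne (hx γ hγ) fun h0 => hγα ((hx' γ hγ).mp h0.symm)
    · have h1 := hΔ.inner_nonneg_of_isDominant hx h
      rw [inner_neg_right, ← inner_refl, (refl_eq_self_iff (hΔ.norm_eq hα)).mpr hxα] at h1
      linarith [hΔ.inner_nonneg_of_isDominant hx hβ]

theorem exists_inner_pos (hΔ : IsSimpleSystem R u Δ) (hβ : β ∈ positiveRoots R u) :
    ∃ α ∈ Δ, 0 < ⟪β, α⟫_ℝ := by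
  by_contra! h
  have hdom : IsDominant Δ (-β) := fun α hα => by
    rw [inner_neg_left]; linarith [h α hα]
  have h1 := hΔ.inner_nonneg_of_isDominant hdom hβ
  rw [inner_neg_left, real_inner_self_eq_norm_sq, hβ.1.1] at h1
  norm_num at h1

/-- Induction on the number of positive roots below β in the order given by ρ. A simple α with ⟨β,
α⟩ > 0 makes s_α β a lower positive root, and its reflection is conjugate to that of β by s_α. -/
theorem refl_mem_closure (hR : IsFiniteReflectionGroup R) (hΔ : IsSimpleSystem R u Δ)
    (hβ : β ∈ positiveRoots R u) : refl β ∈ Subgroup.closure (simpleReflections Δ) := by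
  obtain ⟨ρ, hρ, hρ'⟩ := hΔ.exists_inner_eq_zero_iff hR ∅
  obtain ⟨m, hm⟩ : ∃ m : ℕ,
      m = {γ ∈ positiveRoots R u | ⟪ρ, γ⟫_ℝ < ⟪ρ, β⟫_ℝ}.ncard := ⟨_, rfl⟩
  induction m using Nat.strong_induction_on generalizing β with
  | _ m ih =>
    by_cases hβΔ : β ∈ Δ
    · exact Subgroup.subset_closure ⟨β, hβΔ, rfl⟩
    obtain ⟨α, hα, hpos⟩ := hΔ.exists_inner_pos hβ
    have hne : β ≠ α := fun h => hβΔ (h ▸ hα)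
    have hmem := hΔ.refl_mem_positiveRoots hR hα hβ hne
    have hlt : ⟪ρ, refl α β⟫_ℝ < ⟪ρ, β⟫_ℝ := by
      have hρα : 0 < ⟪ρ, α⟫_ℝ :=
        lt_of_le_of_ne (hρ α hα) fun h0 => ((hρ' α hα).mp h0.symm).elim
      rw [refl_apply (hΔ.norm_eq hα), inner_sub_right, real_inner_smul_right]
      have := mul_pos hpos hρα
      linarith
    have hcl : refl (refl α β) ∈ Subgroup.closure (simpleReflections Δ) := by
      refine ih _ ?_ hmem rfl
      rw [hm]
      refine Set.ncard_lt_ncard ⟨fun γ hγ => ⟨hγ.1, hγ.2.trans hlt⟩, fun hsub => ?_⟩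
        ((finite_positiveRoots hR).subset (Set.sep_subset _ _))
      exact lt_irrefl _ (hsub ⟨hmem, hlt⟩).2
    have hα' : refl α ∈ Subgroup.closure (simpleReflections Δ) :=
      Subgroup.subset_closure ⟨α, hα, rfl⟩
    rw [refl_map_eq hR (hΔ.pos hα).1.2 hβ.1] at hcl
    have h1 := (Subgroup.mul_mem_cancel_right _ (Subgroup.inv_mem _ hα')).mp hcl
    exact (Subgroup.mul_mem_cancel_left _ hα').mp h1

theorem closure_simpleReflections (hR : IsFiniteReflectionGroup R) (hΔ : IsSimpleSystem R u Δ) :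
    Subgroup.closure (simpleReflections Δ) = R := by
  apply le_antisymm
  · rw [Subgroup.closure_le]
    rintro _ ⟨α, hα, rfl⟩
    exact (hΔ.pos hα).1.2
  · nth_rewrite 1 [← hR.2]
    rw [Subgroup.closure_le]
    rintro _ ⟨ht, α, hα, rfl⟩
    rcases mem_positiveRoots_or_neg (u := u) (show α ∈ rootSystem R from ⟨hα, ht⟩) with h | h
    · exact hΔ.refl_mem_closure hR h
    · rw [← refl_neg]
      exact hΔ.refl_mem_closure hR h

end IsSimpleSystem

end ReflGroup

/-! ### Criteria for folds and for percolation -/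

namespace Bigraph

variable {V₁ V₂ : Type*} (G : Bigraph V₁ V₂)

/-- An involutive automorphism that negates a height function which does not change its sign along
edges gives a fold, as soon as the height function does not vanish. -/
theorem isFold_of_height {φ : Equiv.Perm (V₁ ⊕ V₂)} {L : Set (V₁ ⊕ V₂)} (h : V₁ ⊕ V₂ → ℝ)
    (hauto : G.IsAutomorphism φ) (hinv : φ = φ⁻¹) (hφ : ∀ v, h (φ v) = -h v)
    (hfix : ∀ v, φ v = v ↔ h v = 0) (hL : ∀ v, v ∈ L ↔ 0 < h v)
    (hedge : ∀ x y, G.Edge x y → 0 ≤ h x * h y) (hne : ∃ v, h v ≠ 0) : G.IsFold (φ, L) := by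
  have hfp : ∀ v, v ∈ Function.fixedPoints φ ↔ h v = 0 := hfix
  have himg : ∀ v, v ∈ φ '' L ↔ h v < 0 := by
    intro v
    constructor
    · rintro ⟨w, hw, rfl⟩
      rw [hφ]
      linarith [(hL w).mp hw]
    · intro hv
      refine ⟨φ v, (hL _).mpr (by rw [hφ]; linarith), ?_⟩
      nth_rewrite 1 [hinv]
      exact φ.symm_apply_apply v
  -- Off the fixed points the height is non-zero, so its sign is constant along paths.
  have hreach : ∀ a b, (G.delete (Function.fixedPoints φ)).Reachable a b → (0 < h a ↔ 0 < h b) := by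
    rintro a b ⟨p⟩
    induction p with
    | nil => exact Iff.rfl
    | @cons a b c hab _ ih =>
      rw [← ih]
      have ha : h a ≠ 0 := fun h0 => a.2 ((hfp _).mpr h0)
      have hb : h b ≠ 0 := fun h0 => b.2 ((hfp _).mpr h0)
      have hnn : 0 ≤ h a * h b := by
        rcases hab with hab | hab
        · exact hedge _ _ hab
        · rw [mul_comm]
          exact hedge _ _ hab
      exact pos_iff_pos_of_mul_pos (lt_of_le_of_ne hnn (mul_ne_zero ha hb).symm)
  refine ⟨⟨hauto, hinv, fun hpre => ?_⟩, ?_, ?_, ?_, ?_, ?_⟩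
  · obtain ⟨v, hv⟩ := hne
    have hv' : h (φ v) ≠ 0 := by rw [hφ]; exact neg_ne_zero.mpr hv
    have := hreach _ _ (hpre ⟨v, fun h0 => hv ((hfp _).mp h0)⟩
      ⟨φ v, fun h0 => hv' ((hfp _).mp h0)⟩)
    simp only [hφ] at this
    rcases lt_or_gt_of_ne hv with h0 | h0
    · linarith [this.mpr (by linarith)]
    · linarith [this.mp h0]
  · refine ⟨{c | ∃ v, c = SimpleGraph.connectedComponentMk _ v ∧ 0 < h v}, ?_⟩
    ext v
    simp only [Set.mem_iUnion, hL]
    constructor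
    · intro hv
      exact ⟨_, ⟨⟨v, fun h0 => hv.ne' ((hfp _).mp h0)⟩, rfl, hv⟩, _, rfl, rfl⟩
    · rintro ⟨_, ⟨a, rfl, ha⟩, b, hb, rfl⟩
      exact (hreach _ _ (SimpleGraph.ConnectedComponent.exact hb)).mpr ha
  · rw [Set.disjoint_left]
    intro v h1 h2
    exact ((hL v).mp h1).ne' ((hfp v).mp h2)
  · rw [Set.disjoint_left]
    intro v h1 h2
    exact ((himg v).mp h2).ne ((hfp v).mp h1)
  · rw [Set.disjoint_left]
    intro v h1 h2
    exact lt_asymm ((himg v).mp h2) ((hL v).mp h1)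
  · refine Set.eq_univ_of_forall fun v => ?_
    rcases lt_trichotomy (h v) 0 with h0 | h0 | h0
    · exact Or.inr ((himg v).mpr h0)
    · exact Or.inl (Or.inr ((hfp v).mpr h0))
    · exact Or.inl (Or.inl ((hL v).mpr h0))

/-- The composition of the left-folding maps of a list of pairs. -/
noncomputable def listFolding (l : List (Equiv.Perm (V₁ ⊕ V₂) × Set (V₁ ⊕ V₂))) :
    V₁ ⊕ V₂ → V₁ ⊕ V₂ :=
  l.foldr (fun p f => leftFolding p ∘ f) id

theorem listFolding_append (l l' : List (Equiv.Perm (V₁ ⊕ V₂) × Set (V₁ ⊕ V₂))) :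
    listFolding (l ++ l') = listFolding l ∘ listFolding l' := by
  induction l with
  | nil => rfl
  | cons p l ih => exact congrArg (leftFolding p ∘ ·) ih

variable {G}

theorem IsFold.leftFolding_mem_iff {p : Equiv.Perm (V₁ ⊕ V₂) × Set (V₁ ⊕ V₂)} (hp : G.IsFold p)
    (x : V₁ ⊕ V₂) : leftFolding p x ∈ G.leftVerts ↔ x ∈ G.leftVerts := by
  unfold leftFolding
  split_ifs
  · rfl
  · have h := hp.1.1.1
    nth_rewrite 1 [← h]
    exact p.1.injective.mem_set_image

theorem listFolding_mem_iff {l : List (Equiv.Perm (V₁ ⊕ V₂) × Set (V₁ ⊕ V₂))}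
    (hl : ∀ p ∈ l, G.IsFold p) (x : V₁ ⊕ V₂) :
    listFolding l x ∈ G.leftVerts ↔ x ∈ G.leftVerts := by
  induction l with
  | nil => rfl
  | cons p l ih =>
    change leftFolding p (listFolding l x) ∈ _ ↔ _
    rw [(hl p List.mem_cons_self).leftFolding_mem_iff,
      ih fun q hq => hl q (List.mem_cons_of_mem _ hq)]

/-- The sets U are the preimages of v₀ under the compositions of the first i folds. The head of the
list is applied last, so appending a fold takes one more preimage. -/
theorem isLeftCutPercolatingUnder_of_list {S : Set (Equiv.Perm (V₁ ⊕ V₂) × Set (V₁ ⊕ V₂))}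
    (l : List (Equiv.Perm (V₁ ⊕ V₂) × Set (V₁ ⊕ V₂))) (hl : ∀ p ∈ l, G.IsFold p ∧ p ∈ S)
    (v₀ : V₁) (h : ∀ v, listFolding l (Sum.inl v) = Sum.inl v₀) :
    G.IsLeftCutPercolatingUnder S := by
  have hmem : ∀ i, ∀ p ∈ l.take i, G.IsFold p := fun i p hp => (hl p (List.mem_of_mem_take hp)).1
  refine ⟨l.length, fun i => listFolding (l.take i) ⁻¹' {Sum.inl v₀}, fun i => l.get i,
    ⟨fun i x hx => ?_, ?_, ?_, fun i => ⟨(hl _ (l.get_mem i)).1, ?_⟩⟩,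
    fun i => (hl _ (l.get_mem i)).2⟩
  · rw [← listFolding_mem_iff (hmem i), show listFolding (l.take i) x = _ from hx]
    exact ⟨v₀, rfl⟩
  · exact Set.ncard_singleton _
  · ext x
    simp only [Fin.val_last, List.take_length]
    constructor
    · intro hx
      rw [← listFolding_mem_iff (fun p hp => (hl p hp).1), show listFolding l x = _ from hx]
      exact ⟨v₀, rfl⟩
    · rintro ⟨v, rfl⟩
      exact h v
  · simp only [Fin.val_succ, Fin.val_castSucc, List.take_succ_eq_append_getElem i.2,
      listFolding_append]
    rfl

/-- If every left vertex other than `v₀` is raised by some fold that lowers no left vertex, then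
the bigraph is left-cut-percolating. -/
theorem isLeftCutPercolatingUnder_of_potential
    {S : Set (Equiv.Perm (V₁ ⊕ V₂) × Set (V₁ ⊕ V₂))} (q : V₁ ⊕ V₂ → ℝ) (v₀ : V₁)
    (hq : ∀ v ≠ v₀, ∃ p, G.IsFold p ∧ p ∈ S ∧
      q (Sum.inl v) < q (leftFolding p (Sum.inl v)) ∧
      ∀ w : V₁, q (Sum.inl w) ≤ q (leftFolding p (Sum.inl w))) :
    G.IsLeftCutPercolatingUnder S := by
  have := G.finite_left
  have := G.finite_right
  have := Fintype.ofFinite V₁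
  let A : Set (V₁ ⊕ V₂ → V₁ ⊕ V₂) :=
    {F | ∃ l : List _, (∀ p ∈ l, G.IsFold p ∧ p ∈ S) ∧ F = listFolding l}
  -- There are infinitely many lists of folds, but only finitely many self-maps of the vertex set,
  -- so a maximum exists.
  obtain ⟨F, ⟨l, hl, rfl⟩, hmax⟩ := (Set.toFinite A).exists_maximalFor
    (fun F => ∑ v : V₁, q (F (Sum.inl v))) A ⟨_, [], by simp, rfl⟩
  refine isLeftCutPercolatingUnder_of_list l hl v₀ fun v => ?_
  have hleft : ∀ w : V₁, ∃ w' : V₁, Sum.inl w' = listFolding l (Sum.inl w) := fun w =>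
    (listFolding_mem_iff (fun p hp => (hl p hp).1) _).mpr ⟨w, rfl⟩
  by_contra hne
  obtain ⟨v', hv'⟩ := hleft v
  obtain ⟨p, hp, hpS, hlt, hle⟩ := hq v' fun h0 => hne (by rw [← hv', h0])
  have hsum : ∑ w : V₁, q (listFolding l (Sum.inl w)) <
      ∑ w : V₁, q (listFolding (p :: l) (Sum.inl w)) := by
    refine Finset.sum_lt_sum (fun w _ => ?_) ⟨v, Finset.mem_univ _, ?_⟩
    · obtain ⟨w', hw'⟩ := hleft w
      change _ ≤ q (leftFolding p (listFolding l (Sum.inl w)))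
      rw [← hw']
      exact hle w'
    · change _ < q (leftFolding p (listFolding l (Sum.inl v)))
      rw [← hv']
      exact hlt
  refine absurd (hmax (j := listFolding (p :: l)) ⟨p :: l, ?_, rfl⟩ hsum.le) (not_le.mpr hsum)
  intro r hr
  rcases List.mem_cons.mp hr with rfl | hr
  · exact ⟨hp, hpS⟩
  · exact hl r hr

end Bigraph

namespace ReflGroup

open scoped InnerProductSpace

/-! ### Exchange, stabilizers and cosets as points -/

section Cells

variable {n : ℕ} {R : Subgroup (GLE n)}
  {u : Module.Basis (Fin n) ℝ (EuclideanSpace ℝ (Fin n))} {Δ : Set (EuclideanSpace ℝ (Fin n))}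
  {α β x y : EuclideanSpace ℝ (Fin n)} {I : Set (GLE n)}

theorem prod_mem (hΔ : IsSimpleSystem R u Δ) {l : List (EuclideanSpace ℝ (Fin n))}
    (hl : ∀ a ∈ l, a ∈ Δ) : (l.map refl).prod ∈ R :=
  R.list_prod_mem fun t ht => by
    obtain ⟨a, ha, rfl⟩ := List.mem_map.mp ht
    exact (hΔ.pos (hl a ha)).1.2

theorem exists_list (hR : IsFiniteReflectionGroup R) (hΔ : IsSimpleSystem R u Δ) {r : GLE n}
    (hr : r ∈ R) : ∃ l : List (EuclideanSpace ℝ (Fin n)),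
      (∀ a ∈ l, a ∈ Δ) ∧ (l.map refl).prod = r := by
  rw [← hΔ.closure_simpleReflections hR] at hr
  induction hr using Subgroup.closure_induction with
  | mem t ht =>
    obtain ⟨a, ha, rfl⟩ := ht
    exact ⟨[a], by simpa using ha, by simp⟩
  | one => exact ⟨[], by simp, rfl⟩
  | mul a b _ _ ha hb =>
    obtain ⟨l, hl, rfl⟩ := ha
    obtain ⟨l', hl', rfl⟩ := hb
    refine ⟨l ++ l', fun a ha => ?_, by simp⟩
    exact (List.mem_append.mp ha).elim (hl a) (hl' a)
  | inv a _ ha =>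
    obtain ⟨l, hl, rfl⟩ := ha
    refine ⟨l.reverse, fun a ha => hl a (List.mem_reverse.mp ha), ?_⟩
    simp [List.prod_inv_reverse, Function.comp_def, refl_inv]

/-- The exchange property. -/
theorem exists_list_mul_refl (hR : IsFiniteReflectionGroup R) (hΔ : IsSimpleSystem R u Δ)
    (hα : α ∈ Δ) (l : List (EuclideanSpace ℝ (Fin n))) (hl : ∀ a ∈ l, a ∈ Δ)
    (hneg : (l.map refl).prod α ∉ positiveRoots R u) :
    ∃ l' : List (EuclideanSpace ℝ (Fin n)), (∀ a ∈ l', a ∈ Δ) ∧ l'.length + 1 = l.length ∧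
      (l'.map refl).prod = (l.map refl).prod * refl α := by
  induction l with
  | nil => exact absurd (hΔ.pos hα) hneg
  | cons s l ih =>
    have hs : s ∈ Δ := hl s List.mem_cons_self
    have hl' : ∀ a ∈ l, a ∈ Δ := fun a ha => hl a (List.mem_cons_of_mem _ ha)
    rw [List.map_cons, List.prod_cons, LinearEquiv.mul_apply] at hneg
    by_cases hpos : (l.map refl).prod α ∈ positiveRoots R u
    · have heq : (l.map refl).prod α = s := by
        by_contra hne
        exact hneg (hΔ.refl_mem_positiveRoots hR hs hpos hne)
      refine ⟨l, hl', rfl, ?_⟩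
      have h := refl_map_eq hR (prod_mem hΔ hl') (hΔ.pos hα).1
      rw [heq] at h
      rw [List.map_cons, List.prod_cons, h, inv_mul_cancel_right, mul_assoc, refl_mul_self, mul_one]
    · obtain ⟨l', h1, h2, h3⟩ := ih hl' hpos
      refine ⟨s :: l', fun a ha => ?_, by simp [h2], by simp [h3, mul_assoc]⟩
      rcases List.mem_cons.mp ha with rfl | ha
      · exact hs
      · exact h1 a ha

/-- If `x` and `r x` are both dominant, then `r` is a product of simple reflections that fix `x`. -/
theorem prod_mem_closure (hR : IsFiniteReflectionGroup R) (hΔ : IsSimpleSystem R u Δ)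
    (hx : IsDominant Δ x) (l : List (EuclideanSpace ℝ (Fin n))) (hl : ∀ a ∈ l, a ∈ Δ)
    (hdom : IsDominant Δ ((l.map refl).prod x)) :
    (l.map refl).prod ∈ Subgroup.closure (refl '' {α ∈ Δ | ⟪x, α⟫_ℝ = 0}) := by
  obtain ⟨m, hm⟩ : ∃ m, m = l.length := ⟨_, rfl⟩
  induction m using Nat.strong_induction_on generalizing l with
  | _ m ih =>
    rcases List.eq_nil_or_concat l with rfl | ⟨l₁, α, rfl⟩
    · exact Subgroup.one_mem _
    have hl₁ : ∀ a ∈ l₁, a ∈ Δ := fun a ha => hl a (by simp [ha])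
    have hα : α ∈ Δ := hl α (by simp)
    have hprod : ((l₁.concat α).map refl).prod = (l₁.map refl).prod * refl α := by simp
    rw [hprod] at hdom ⊢
    -- If the prefix keeps α positive, dominance of both points forces ⟨x, α⟩ = 0, so the last
    -- letter fixes x and can be split off. Otherwise exchange gives a word for the same product
    -- with two letters fewer.
    by_cases hpos : (l₁.map refl).prod α ∈ positiveRoots R u
    · have h1 := hΔ.inner_nonneg_of_isDominant hdom hpos
      rw [LinearEquiv.mul_apply, inner_map_map hR (prod_mem hΔ hl₁), inner_refl,
        refl_self (hΔ.norm_eq hα), inner_neg_right] at h1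
      have h0 : ⟪x, α⟫_ℝ = 0 := le_antisymm (by linarith) (hx α hα)
      refine Subgroup.mul_mem _ (ih l₁.length ?_ l₁ hl₁ ?_ rfl)
        (Subgroup.subset_closure ⟨α, ⟨hα, h0⟩, rfl⟩)
      · simp [hm]
      · rwa [LinearEquiv.mul_apply, (refl_eq_self_iff (hΔ.norm_eq hα)).mpr h0] at hdom
    · obtain ⟨l', h1, h2, h3⟩ := exists_list_mul_refl hR hΔ hα l₁ hl₁ hpos
      rw [← h3] at hdom ⊢
      refine ih l'.length ?_ l' h1 hdom rfl
      simp only [hm, List.length_concat]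
      omega

theorem mem_hyperplane_iff (hβ : β ∈ positiveRoots R u) :
    x ∈ hyperplane R u (refl β) ↔ ⟪x, β⟫_ℝ = 0 := by
  constructor
  · rintro ⟨γ, hγ, h, h'⟩
    rwa [← eq_of_refl_eq hγ hβ h]
  · exact fun h => ⟨β, hβ, rfl, h⟩

theorem mem_posHalfSpace_iff (hβ : β ∈ positiveRoots R u) :
    x ∈ posHalfSpace R u (refl β) ↔ 0 < ⟪x, β⟫_ℝ := by
  constructor
  · rintro ⟨γ, hγ, h, h'⟩
    rwa [← eq_of_refl_eq hγ hβ h]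
  · exact fun h => ⟨β, hβ, rfl, h⟩

theorem mem_cell_iff (hΔ : IsSimpleSystem R u Δ) (hI : I ⊆ simpleReflections Δ) :
    x ∈ cell R u Δ I ↔ IsDominant Δ x ∧ ∀ α ∈ Δ, ⟪x, α⟫_ℝ = 0 ↔ refl α ∈ I := by
  simp only [cell, Set.mem_inter_iff, Set.mem_iInter]
  constructor
  · rintro ⟨h1, h2⟩
    have h0 : ∀ α ∈ Δ, refl α ∈ I → ⟪x, α⟫_ℝ = 0 := fun α hα h =>
      (mem_hyperplane_iff (hΔ.pos hα)).mp (h1 _ h)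
    have hp : ∀ α ∈ Δ, refl α ∉ I → 0 < ⟪x, α⟫_ℝ := fun α hα h =>
      (mem_posHalfSpace_iff (hΔ.pos hα)).mp (h2 _ ⟨⟨α, hα, rfl⟩, h⟩)
    refine ⟨fun α hα => ?_, fun α hα => ⟨fun h => ?_, h0 α hα⟩⟩
    · by_cases h : refl α ∈ I
      · exact (h0 α hα h).ge
      · exact (hp α hα h).le
    · by_contra h'
      exact (hp α hα h').ne' h
  · rintro ⟨h1, h2⟩
    refine ⟨fun s hs => ?_, ?_⟩
    · obtain ⟨α, hα, rfl⟩ := hI hs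
      exact (mem_hyperplane_iff (hΔ.pos hα)).mpr ((h2 α hα).mpr hs)
    · rintro _ ⟨⟨α, hα, rfl⟩, hs⟩
      exact (mem_posHalfSpace_iff (hΔ.pos hα)).mpr
        (lt_of_le_of_ne (h1 α hα) fun h => hs ((h2 α hα).mp h.symm))

theorem cell_nonempty (hR : IsFiniteReflectionGroup R) (hΔ : IsSimpleSystem R u Δ)
    (hI : I ⊆ simpleReflections Δ) : (cell R u Δ I).Nonempty := by
  obtain ⟨x, hx, hx'⟩ := hΔ.exists_inner_eq_zero_iff hR {α | refl α ∈ I}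
  exact ⟨x, (mem_cell_iff hΔ hI).mpr ⟨hx, hx'⟩⟩

theorem mem_closure_of_isDominant (hR : IsFiniteReflectionGroup R) (hΔ : IsSimpleSystem R u Δ)
    (hI : I ⊆ simpleReflections Δ) (hx : x ∈ cell R u Δ I) {r : GLE n} (hr : r ∈ R)
    (h : IsDominant Δ (r x)) : r ∈ Subgroup.closure I := by
  rw [mem_cell_iff hΔ hI] at hx
  obtain ⟨l, hl, rfl⟩ := exists_list hR hΔ hr
  refine Subgroup.closure_mono ?_ (prod_mem_closure hR hΔ hx.1 l hl h)
  rintro _ ⟨α, ⟨hα, h0⟩, rfl⟩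
  exact (hx.2 α hα).mp h0

theorem map_eq_of_mem_closure (hΔ : IsSimpleSystem R u Δ) (hI : I ⊆ simpleReflections Δ)
    (hx : x ∈ cell R u Δ I) {r : GLE n} (hr : r ∈ Subgroup.closure I) : r x = x := by
  rw [mem_cell_iff hΔ hI] at hx
  induction hr using Subgroup.closure_induction with
  | mem t ht =>
    obtain ⟨α, hα, rfl⟩ := hI ht
    exact (refl_eq_self_iff (hΔ.norm_eq hα)).mpr ((hx.2 α hα).mpr ht)
  | one => rfl
  | mul a b _ _ ha hb => rw [LinearEquiv.mul_apply, hb, ha]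
  | inv a _ ha =>
    nth_rewrite 1 [← ha]
    exact a.symm_apply_apply x

/-- The subgroup generated by `I` is the stabilizer of every point of the cell of `I`. -/
theorem mem_closure_iff (hR : IsFiniteReflectionGroup R) (hΔ : IsSimpleSystem R u Δ)
    (hI : I ⊆ simpleReflections Δ) (hx : x ∈ cell R u Δ I) {r : GLE n} (hr : r ∈ R) :
    r ∈ Subgroup.closure I ↔ r x = x :=
  ⟨map_eq_of_mem_closure hΔ hI hx, fun h => mem_closure_of_isDominant hR hΔ hI hx hr
    (h.symm ▸ ((mem_cell_iff hΔ hI).mp hx).1)⟩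

/-- Dominance of x makes β positive, so its product with y is non-negative. If it were 0, the
reflection would stabilize y, hence also x, as all points of a cell have the same stabilizer. -/
theorem inner_pos_of_mem_cell (hR : IsFiniteReflectionGroup R) (hΔ : IsSimpleSystem R u Δ)
    (hI : I ⊆ simpleReflections Δ) (hx : x ∈ cell R u Δ I) (hy : y ∈ cell R u Δ I)
    (hβ : β ∈ rootSystem R) (h : 0 < ⟪x, β⟫_ℝ) : 0 < ⟪y, β⟫_ℝ := by
  have hpos : β ∈ positiveRoots R u := (mem_positiveRoots_or_neg hβ).resolve_right fun hneg => by
    have := hΔ.inner_nonneg_of_isDominant ((mem_cell_iff hΔ hI).mp hx).1 hneg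
    rw [inner_neg_right] at this
    linarith
  refine lt_of_le_of_ne
    (hΔ.inner_nonneg_of_isDominant ((mem_cell_iff hΔ hI).mp hy).1 hpos) fun h0 => ?_
  have h1 := (mem_closure_iff hR hΔ hI hy hβ.2).mpr ((refl_eq_self_iff hβ.1).mpr h0.symm)
  rw [mem_closure_iff hR hΔ hI hx hβ.2, refl_eq_self_iff hβ.1] at h1
  exact h.ne' h1

theorem image_cell_subset_iff (hR : IsFiniteReflectionGroup R) (hΔ : IsSimpleSystem R u Δ)
    (hI : I ⊆ simpleReflections Δ) (hx : x ∈ cell R u Δ I) (hβ : β ∈ positiveRoots R u)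
    {r : GLE n} (hr : r ∈ R) :
    r '' cell R u Δ I ⊆ posHalfSpace R u (refl β) ↔ 0 < ⟪r x, β⟫_ℝ := by
  constructor
  · exact fun h => (mem_posHalfSpace_iff hβ).mp (h ⟨x, hx, rfl⟩)
  · rintro h _ ⟨y, hy, rfl⟩
    rw [mem_posHalfSpace_iff hβ]
    rw [inner_map_left hR hr] at h ⊢
    exact inner_pos_of_mem_cell hR hΔ hI hx hy (map_mem_rootSystem hR (R.inv_mem hr) hβ.1) h

/-- The image of the point `x` under (a representative of) a left coset. -/
noncomputable def cosetPoint (x : EuclideanSpace ℝ (Fin n)) (v : R ⧸ gen R I) :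
    EuclideanSpace ℝ (Fin n) :=
  ((Quotient.out v : R) : GLE n) x

theorem coe_eq_coe_iff (hR : IsFiniteReflectionGroup R) (hΔ : IsSimpleSystem R u Δ)
    (hI : I ⊆ simpleReflections Δ) (hx : x ∈ cell R u Δ I) (r s : R) :
    (r : R ⧸ gen R I) = (s : R ⧸ gen R I) ↔ (r : GLE n) x = (s : GLE n) x := by
  rw [QuotientGroup.eq, gen, Subgroup.mem_subgroupOf,
    mem_closure_iff hR hΔ hI hx (r⁻¹ * s).2, Subgroup.coe_mul, LinearEquiv.mul_apply, eq_comm]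
  exact LinearEquiv.eq_symm_apply (r : GLE n)

theorem cosetPoint_coe (hR : IsFiniteReflectionGroup R) (hΔ : IsSimpleSystem R u Δ)
    (hI : I ⊆ simpleReflections Δ) (hx : x ∈ cell R u Δ I) (r : R) :
    cosetPoint x (r : R ⧸ gen R I) = (r : GLE n) x :=
  (coe_eq_coe_iff hR hΔ hI hx _ _).mp (Quotient.out_eq _)

theorem cosetPoint_smul (hR : IsFiniteReflectionGroup R) (hΔ : IsSimpleSystem R u Δ)
    (hI : I ⊆ simpleReflections Δ) (hx : x ∈ cell R u Δ I) (t : R) (v : R ⧸ gen R I) :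
    cosetPoint x (t • v) = (t : GLE n) (cosetPoint x v) := by
  induction v using QuotientGroup.induction_on with
  | H r =>
    rw [cosetPoint_coe hR hΔ hI hx]
    exact cosetPoint_coe hR hΔ hI hx (t * r)

theorem cosetPoint_injective (hR : IsFiniteReflectionGroup R) (hΔ : IsSimpleSystem R u Δ)
    (hI : I ⊆ simpleReflections Δ) (hx : x ∈ cell R u Δ I) :
    Function.Injective (cosetPoint x : R ⧸ gen R I → _) := by
  intro v w h
  induction v using QuotientGroup.induction_on with
  | H r =>
    induction w using QuotientGroup.induction_on with
    | H s =>
      rw [cosetPoint_coe hR hΔ hI hx, cosetPoint_coe hR hΔ hI hx] at h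
      exact (coe_eq_coe_iff hR hΔ hI hx _ _).mpr h

end Cells

/-! ### Reflections as folds of the bigraph -/

section Folds

variable {n k : ℕ} {R : Subgroup (GLE n)}
  {u : Module.Basis (Fin n) ℝ (EuclideanSpace ℝ (Fin n))} {Δ : Set (EuclideanSpace ℝ (Fin n))}
  {α : EuclideanSpace ℝ (Fin n)} {S₀ : Set (GLE n)} {S : Fin k → Set (GLE n)}

theorem reflectionPerm_inl (t : R) (v : R ⧸ gen R S₀) :
    reflectionPerm R S₀ S t (Sum.inl v) = Sum.inl (t • v) := rfl

theorem reflectionPerm_inr (t : R) (i : Fin k) (v : R ⧸ gen R (S i)) :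
    reflectionPerm R S₀ S t (Sum.inr ⟨i, v⟩) = Sum.inr ⟨i, t • v⟩ := rfl

theorem isAutomorphism_reflectionPerm (hR : IsFiniteReflectionGroup R) (t : R) :
    (leftReflectionBigraph R hR S₀ S).IsAutomorphism (reflectionPerm R S₀ S t) := by
  have hadj : ∀ (s : R) x y, (leftReflectionBigraph R hR S₀ S).Edge x y →
      (leftReflectionBigraph R hR S₀ S).Edge (reflectionPerm R S₀ S s x)
        (reflectionPerm R S₀ S s y) := by
    rintro s _ _ ⟨_, _, rfl, rfl, r, i, rfl, rfl⟩
    exact ⟨_, _, rfl, rfl, s * r, i, rfl, rfl⟩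
  have hinv : ∀ x, reflectionPerm R S₀ S t⁻¹ (reflectionPerm R S₀ S t x) = x := by
    rintro (v | ⟨i, v⟩) <;> simp [reflectionPerm]
  refine ⟨?_, ?_, fun x y => ⟨hadj t x y, fun h => ?_⟩⟩
  · ext x
    constructor
    · rintro ⟨_, ⟨v, rfl⟩, rfl⟩
      exact ⟨t • v, rfl⟩
    · rintro ⟨v, rfl⟩
      exact ⟨_, ⟨t⁻¹ • v, rfl⟩, congrArg Sum.inl (smul_inv_smul t v)⟩
  · ext x
    constructor
    · rintro ⟨_, ⟨⟨i, v⟩, rfl⟩, rfl⟩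
      exact ⟨⟨i, t • v⟩, rfl⟩
    · rintro ⟨⟨i, v⟩, rfl⟩
      exact ⟨_, ⟨⟨i, t⁻¹ • v⟩, rfl⟩, congrArg (fun w => Sum.inr (Sigma.mk i w)) (smul_inv_smul t v)⟩
  · have := hadj t⁻¹ _ _ h
    rwa [hinv, hinv] at this

/-- The inner product with `α` of the point that belongs to a vertex. -/
noncomputable def height (S₀ : Set (GLE n)) (S : Fin k → Set (GLE n))
    (x₀ : EuclideanSpace ℝ (Fin n)) (x : Fin k → EuclideanSpace ℝ (Fin n))
    (α : EuclideanSpace ℝ (Fin n)) :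
    (R ⧸ gen R S₀) ⊕ (Σ i : Fin k, R ⧸ gen R (S i)) → ℝ :=
  Sum.elim (fun v => ⟪cosetPoint x₀ v, α⟫_ℝ) fun w => ⟪cosetPoint (x w.1) w.2, α⟫_ℝ

theorem height_inl (x₀ : EuclideanSpace ℝ (Fin n)) (x : Fin k → EuclideanSpace ℝ (Fin n))
    (v : R ⧸ gen R S₀) : height S₀ S x₀ x α (Sum.inl v) = ⟪cosetPoint x₀ v, α⟫_ℝ := rfl

theorem height_inr (x₀ : EuclideanSpace ℝ (Fin n)) (x : Fin k → EuclideanSpace ℝ (Fin n))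
    (i : Fin k) (v : R ⧸ gen R (S i)) :
    height S₀ S x₀ x α (Sum.inr ⟨i, v⟩) = ⟪cosetPoint (x i) v, α⟫_ℝ := rfl

theorem mem_reflectionSide_iff (hR : IsFiniteReflectionGroup R) (hΔ : IsSimpleSystem R u Δ)
    (hS₀ : S₀ ⊆ simpleReflections Δ) (hS : ∀ i, S i ⊆ simpleReflections Δ)
    {x₀ : EuclideanSpace ℝ (Fin n)} {x : Fin k → EuclideanSpace ℝ (Fin n)}
    (hx₀ : x₀ ∈ cell R u Δ S₀) (hx : ∀ i, x i ∈ cell R u Δ (S i))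
    (hα : α ∈ positiveRoots R u) (v : (R ⧸ gen R S₀) ⊕ (Σ i : Fin k, R ⧸ gen R (S i))) :
    v ∈ reflectionSide R u Δ S₀ S ⟨refl α, hα.1.2⟩ ↔ 0 < height S₀ S x₀ x α v := by
  constructor
  · rintro (⟨r, rfl, h⟩ | ⟨i, r, rfl, h⟩)
    · change 0 < ⟪cosetPoint x₀ _, α⟫_ℝ
      rw [cosetPoint_coe hR hΔ hS₀ hx₀]
      exact (image_cell_subset_iff hR hΔ hS₀ hx₀ hα r.2).mp h
    · change 0 < ⟪cosetPoint (x i) _, α⟫_ℝ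
      rw [cosetPoint_coe hR hΔ (hS i) (hx i)]
      exact (image_cell_subset_iff hR hΔ (hS i) (hx i) hα r.2).mp h
  · intro h
    rcases v with v | ⟨i, v⟩
    · exact Or.inl ⟨Quotient.out v, congrArg Sum.inl (Quotient.out_eq v).symm,
        (image_cell_subset_iff hR hΔ hS₀ hx₀ hα (Quotient.out v).2).mpr h⟩
    · exact Or.inr ⟨i, Quotient.out v,
        congrArg (fun w => Sum.inr (Sigma.mk i w)) (Quotient.out_eq v).symm,
        (image_cell_subset_iff hR hΔ (hS i) (hx i) hα (Quotient.out v).2).mpr h⟩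

theorem inner_mul_inner_nonneg (hΔ : IsSimpleSystem R u Δ) {x y β : EuclideanSpace ℝ (Fin n)}
    (hx : IsDominant Δ x) (hy : IsDominant Δ y) (hβ : β ∈ rootSystem R) :
    0 ≤ ⟪x, β⟫_ℝ * ⟪y, β⟫_ℝ := by
  rcases mem_positiveRoots_or_neg (u := u) hβ with h | h
  · exact mul_nonneg (hΔ.inner_nonneg_of_isDominant hx h) (hΔ.inner_nonneg_of_isDominant hy h)
  · have := mul_nonneg (hΔ.inner_nonneg_of_isDominant hx h) (hΔ.inner_nonneg_of_isDominant hy h)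
    rwa [inner_neg_right, inner_neg_right, neg_mul_neg] at this

theorem smul_eq_self_iff (hR : IsFiniteReflectionGroup R) (hΔ : IsSimpleSystem R u Δ)
    {I : Set (GLE n)} (hI : I ⊆ simpleReflections Δ) {x : EuclideanSpace ℝ (Fin n)}
    (hx : x ∈ cell R u Δ I) (hα : α ∈ rootSystem R) (v : R ⧸ gen R I) :
    (⟨refl α, hα.2⟩ : R) • v = v ↔ ⟪cosetPoint x v, α⟫_ℝ = 0 := by
  rw [← refl_eq_self_iff hα.1, ← (cosetPoint_injective hR hΔ hI hx).eq_iff,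
    cosetPoint_smul hR hΔ hI hx]

/-- The hypothesis `hne` is needed: a reflection that fixes all vertices leaves nothing to
disconnect. -/
theorem isFold_reflection (hR : IsFiniteReflectionGroup R) (hΔ : IsSimpleSystem R u Δ)
    (hS₀ : S₀ ⊆ simpleReflections Δ) (hS : ∀ i, S i ⊆ simpleReflections Δ)
    {x₀ : EuclideanSpace ℝ (Fin n)} {x : Fin k → EuclideanSpace ℝ (Fin n)}
    (hx₀ : x₀ ∈ cell R u Δ S₀) (hx : ∀ i, x i ∈ cell R u Δ (S i))
    (hα : α ∈ positiveRoots R u) (hne : ∃ v, height (R := R) S₀ S x₀ x α v ≠ 0) :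
    (leftReflectionBigraph R hR S₀ S).IsFold
      (reflectionPerm R S₀ S ⟨refl α, hα.1.2⟩,
        reflectionSide R u Δ S₀ S ⟨refl α, hα.1.2⟩) := by
  refine Bigraph.isFold_of_height _ (height S₀ S x₀ x α) (isAutomorphism_reflectionPerm hR _) ?_
    ?_ ?_ (mem_reflectionSide_iff hR hΔ hS₀ hS hx₀ hx hα) ?_ hne
  · refine eq_inv_of_mul_eq_one_left (Equiv.ext ?_)
    have hsq : (⟨refl α, hα.1.2⟩ : R) * ⟨refl α, hα.1.2⟩ = 1 := Subtype.ext refl_mul_self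
    rintro (v | ⟨i, v⟩)
    · rw [Equiv.Perm.mul_apply, reflectionPerm_inl, reflectionPerm_inl, smul_smul, hsq, one_smul,
        Equiv.Perm.one_apply]
    · rw [Equiv.Perm.mul_apply, reflectionPerm_inr, reflectionPerm_inr, smul_smul, hsq, one_smul,
        Equiv.Perm.one_apply]
  · have hneg : ∀ y, ⟪refl α y, α⟫_ℝ = -⟪y, α⟫_ℝ := fun y => by
      rw [inner_refl, refl_self hα.1.1, inner_neg_right]
    rintro (v | ⟨i, v⟩)
    · rw [reflectionPerm_inl, height_inl, height_inl, cosetPoint_smul hR hΔ hS₀ hx₀, hneg]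
    · rw [reflectionPerm_inr, height_inr, height_inr, cosetPoint_smul hR hΔ (hS i) (hx i), hneg]
  · rintro (v | ⟨i, v⟩)
    · rw [reflectionPerm_inl, height_inl, ← smul_eq_self_iff hR hΔ hS₀ hx₀ hα.1 v]
      exact Sum.inl_injective.eq_iff
    · rw [reflectionPerm_inr, height_inr, ← smul_eq_self_iff hR hΔ (hS i) (hx i) hα.1 v]
      exact (Sum.inr_injective.comp sigma_mk_injective).eq_iff
  · rintro _ _ ⟨_, _, rfl, rfl, r, i, rfl, rfl⟩
    rw [height_inl, height_inr, cosetPoint_coe hR hΔ hS₀ hx₀, cosetPoint_coe hR hΔ (hS i) (hx i),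
      inner_map_left hR r.2, inner_map_left hR r.2]
    exact inner_mul_inner_nonneg hΔ ((mem_cell_iff hΔ hS₀).mp hx₀).1
      ((mem_cell_iff hΔ (hS i)).mp (hx i)).1 (map_mem_rootSystem hR (R.inv_mem r.2) hα.1)

end Folds

end ReflGroup

/-! ### Percolation by simple reflections -/

theorem mainTheorem3 {n k : ℕ}
    (R : Subgroup (ReflGroup.GLE n)) (hR : ReflGroup.IsFiniteReflectionGroup R)
    (u : Module.Basis (Fin n) ℝ (EuclideanSpace ℝ (Fin n)))
    (Δ : Set (EuclideanSpace ℝ (Fin n))) (hΔ : ReflGroup.IsSimpleSystem R u Δ)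
    (S₀ : Set (ReflGroup.GLE n)) (hS₀ : S₀ ⊆ ReflGroup.simpleReflections Δ)
    (S : Fin k → Set (ReflGroup.GLE n)) (hS : ∀ i, S i ⊆ ReflGroup.simpleReflections Δ) :
    (ReflGroup.leftReflectionBigraph R hR S₀ S).IsLeftCutPercolatingUnder
      (ReflGroup.reflectionFolds R u Δ S₀ S) := by
  open ReflGroup in
  obtain ⟨x₀, hx₀⟩ := cell_nonempty hR hΔ hS₀
  choose x hx using fun i => cell_nonempty hR hΔ (hS i)
  obtain ⟨ρ, hρ, hρ'⟩ := hΔ.exists_inner_eq_zero_iff hR ∅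
  refine Bigraph.isLeftCutPercolatingUnder_of_potential (height S₀ S x₀ x ρ)
    ((1 : R) : R ⧸ gen R S₀) fun v hv => ?_
  -- Only the base vertex has a dominant point: an element of R that keeps `x₀` dominant lies in R₀.
  have hnd : ¬ IsDominant Δ (cosetPoint x₀ v) := by
    intro h
    refine hv (cosetPoint_injective hR hΔ hS₀ hx₀ ?_)
    rw [cosetPoint_coe hR hΔ hS₀ hx₀]
    exact map_eq_of_mem_closure hΔ hS₀ hx₀
      (mem_closure_of_isDominant hR hΔ hS₀ hx₀ (Quotient.out v).2 h)
  obtain ⟨α, hα, hneg⟩ : ∃ α ∈ Δ, inner ℝ (cosetPoint x₀ v) α < 0 := by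
    simpa [IsDominant] using hnd
  have hρα : 0 < inner ℝ ρ α := lt_of_le_of_ne (hρ α hα) fun h0 => ((hρ' α hα).mp h0.symm).elim
  have hraise : ∀ w : R ⧸ gen R S₀,
      height S₀ S x₀ x ρ (reflectionPerm R S₀ S ⟨refl α, (hΔ.pos hα).1.2⟩ (Sum.inl w)) =
        height S₀ S x₀ x ρ (Sum.inl w) - 2 * inner ℝ (cosetPoint x₀ w) α * inner ℝ ρ α := by
    intro w
    rw [reflectionPerm_inl, height_inl, height_inl, cosetPoint_smul hR hΔ hS₀ hx₀,
      refl_apply (hΔ.norm_eq hα), inner_sub_left, real_inner_smul_left, real_inner_comm ρ α]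
  have hside := mem_reflectionSide_iff hR hΔ hS₀ hS hx₀ hx (hΔ.pos hα)
  refine ⟨(reflectionPerm R S₀ S ⟨refl α, (hΔ.pos hα).1.2⟩,
    reflectionSide R u Δ S₀ S ⟨refl α, (hΔ.pos hα).1.2⟩),
    isFold_reflection hR hΔ hS₀ hS hx₀ hx (hΔ.pos hα) ⟨Sum.inl v, hneg.ne⟩,
    ⟨_, ⟨α, hΔ.norm_eq hα, rfl⟩, rfl⟩, ?_, fun w => ?_⟩
  -- Since v has negative height, it is off the chosen side and is reflected, gaining -2⟨p, α⟩⟨ρ, α⟩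
  -- > 0, where p is its point.
  · have hv' : ¬ 0 < inner ℝ (cosetPoint x₀ v) α := not_lt.mpr hneg.le
    rw [Bigraph.leftFolding, if_neg (fun h => hv' ((hside (Sum.inl v)).mp h)), hraise v]
    nlinarith [mul_pos (neg_pos.mpr hneg) hρα]
  · rw [Bigraph.leftFolding]
    split_ifs with h
    · exact le_rfl
    · have hw : ¬ 0 < inner ℝ (cosetPoint x₀ w) α := fun h' => h ((hside (Sum.inl w)).mpr h')
      rw [hraise w]
      nlinarith [mul_nonneg (neg_nonneg.mpr (not_lt.mp hw)) hρα.le]
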